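/- **Setting.** Paulis are taken modulo phases. A circuit is a sequence of time steps; its fault locations are the qubits at each moment between steps, a fault $F$ is a Pauli on the fault locations, and $C^F$ is the circuit with these Paulis inserted, regarded as a family of linear maps $C^F(k)$ indexed by the measurement outcomes $k$. A noise model is a set of atomic faults; it generates the group of possible faults, and the weight $wt(F)$ of a possible fault is the least number of atomic faults whose product is $F$. A detecting set is a set of measurements the parity of whose outcomes is predetermined in the fault-free circuit, and $F$ is detectable if it flips the parity of some detecting set. Let $C_1,C_2$ be circuits, where the outcomes of $C_1$ are computed from those of $C_2$ as $k=\pi(k')$. We write $C_1^{F_1}=C_2^{F_2}$ if, for all $k'$, $C_2^{F_2}(k')$ equals $C_1^{F_1}(\pi(k'))$ up to a phase and a positive normalisation independent of $k'$, and every $k$ with $C_1^{F_1}(k)\neq 0$ is of the form $\pi(k')$. The circuits are *$w$-fault-equivalent* if each possible fault $F_1$ of $C_1$ with $wt(F_1)<w$ is detectable or has a possible fault $F_2$ of $C_2$ with $wt(F_2)\le wt(F_1)$ and $C_1^{F_1}=C_2^{F_2}$, and the same holds with the roles of $C_1$ and $C_2$ exchanged. They are *fault-equivalent* if they are $w$-fault-equivalent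 for all $w\in\mathbb N$. **Proposition (correctness of Steane-style syndrome extraction).** Let $S=[S_1,\dots,S_m]$ be the stabilisers of a CSS stabiliser code of distance $d$ on $n$ qubits (each $S_i$ is a product of $X$'s or a product of $Z$'s on a set of qubits $\mathrm{supp}(S_i)$, and the $S_i$ commute; they may be redundant). Let $enc$ be any encoder of the code, i.e. an injective linear map from $\kappa$ qubits onto the code space. Then the following two circuits are fault-equivalent, in particular $d$-fault-equivalent when $d$ is finite. 1. *Ideal syndrome extraction:* apply $enc$, then measure $S_1,\dots,S_m$ perfectly, with outcomes $k_1,\dots,k_m$. The only atomic faults are single-qubit Paulis on the data qubits before and after the whole sequence of measurements. 2. *Steane-style syndrome extraction:* apply $enc$; prepare an ancilla block in the logical state $|0\cdots0\rangle_L$, apply transversal CNOTs with controls on the ancilla block and targets on the data, and measure the ancilla qubits destructively in the $X$ basis, with outcomes $k'_1,\dots,k'_n$; then prepare an ancilla block in the logical state $|{+}\cdots{+}\rangle_L$, apply transversal CNOTs with controls on the data and targets on the ancilla block, and measure the ancilla qubits destructively in the $Z$ basis, with outcomes $k'_{n+1},\dots,k'_{2n}$. The encoder and the preparations of the two logical states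 are fault-free and the input wires of the encoder are noiseless; otherwise the noise is circuit-level noise: the atomic faults are arbitrary single-qubit Paulis on each qubit after each step, arbitrary two-qubit Paulis on the outputs of each CNOT, and measurement flips. Here the stabiliser outcomes are the parities of the transversal measurement outcomes, $$k_i=\begin{cases}\bigoplus_{j\in \mathrm{supp}(S_i)}k'_j&\text{if } S_i \text{ is an } X\text{-stabiliser},\\ \bigoplus_{j\in \mathrm{supp}(S_i)}k'_{n+j}&\text{if } S_i \text{ is a } Z\text{-stabiliser}.\end{cases}$$ The logical states are $|0\cdots0\rangle_L\propto\sum_{x}|x\rangle$ over the span over $\mathbb F_2$ of the supports of the $X$-stabilisers, and $|{+}\cdots{+}\rangle_L\propto\sum_x|x\rangle$ over all $x\in\mathbb F_2^n$ that are orthogonal to the supports of all $Z$-stabilisers. -/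

import Mathlib

open Matrix

noncomputable section

namespace FaultEq

/-! ### Qubits and Pauli operators

The computational basis of a register of qubits `Q` is `Q → ZMod 2`, and linear maps are matrices
in these bases. -/

/-- Basis vectors (bit strings) of the register `Q`. -/
abbrev Bits (Q : Type) : Type := Q → ZMod 2

/-- Pauli operators on the locations `L` modulo phases: `(a, b)` stands for `X ^ a * Z ^ b`.
The addition is the multiplication of Paulis modulo phases. -/
abbrev Pauli (L : Type) : Type := L → ZMod 2 × ZMod 2

/-- The sign `(-1) ^ b`. -/
def sgn (b : ZMod 2) : ℂ := if b = 0 then 1 else -1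

/-- The operator that a Pauli stands for (up to phase): it sends the basis vector `b` to
`(-1) ^ (z ⬝ b)` times the basis vector `b + x`. It is Hermitian if `x = 0` or `z = 0`. -/
def pauliOp {Q : Type} [Fintype Q] [DecidableEq Q] (p : Pauli Q) :
    Matrix (Bits Q) (Bits Q) ℂ :=
  fun a b => if a = (fun q => b q + (p q).1) then sgn (∑ q, (p q).2 * b q) else 0

/-- The number of locations on which a Pauli acts non-trivially. -/
def pauliWeight {Q : Type} [Fintype Q] (p : Pauli Q) : ℕ :=
  (Finset.univ.filter fun q => p q ≠ 0).card

/-- Two Paulis commute iff their symplectic product vanishes. -/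
def PauliCommute {Q : Type} [Fintype Q] (p r : Pauli Q) : Prop :=
  ∑ q, ((p q).1 * (r q).2 + (p q).2 * (r q).1) = 0

/-! ### Circuits with measurement outcomes and noise -/

/-- One time step of a circuit, from the register `P` to the register `Q`. The linear map `op k`
depends on the outcomes `k` of the measurements, which are labelled by `O`. An element `(a, b)` of
`faults` is an atomic fault that puts the Pauli `a` immediately before the step and the Pauli `b`
immediately after it. A fault-free step has `faults = ∅`. -/
structure Gate (O P Q : Type) where
  op : Bits O → Matrix (Bits Q) (Bits P) ℂ
  faults : Set (Pauli P × Pauli Q)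

/-- Circuits with outcome labels `O` from the register `P` to the register `R`: an alternating
sequence of wires and steps. `noisy` is the set of non-idealised wires of a moment in time. -/
inductive Circuit (O : Type) : Type → Type → Type 1
  | wires (Q : Type) [Fintype Q] [DecidableEq Q] (noisy : Set Q) : Circuit O Q Q
  | step {P Q R : Type} [Fintype P] [DecidableEq P] [Fintype Q] [DecidableEq Q]
      (noisy : Set P) (g : Gate O P Q) (c : Circuit O Q R) : Circuit O P R

namespace Circuit

variable {O : Type}

/-- The fault locations: the qubits at each moment in time. -/
def Loc : {P R : Type} → Circuit O P R → Type
  | _, _, wires Q _ => Q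
  | _, _, step (P := P) _ _ c => P ⊕ Loc c

/-- A fault is a Pauli (modulo phase) on the fault locations. -/
abbrev Fault {P R : Type} (c : Circuit O P R) : Type := Pauli (Loc c)

/-- The fault that acts as `p` on the input wires and trivially elsewhere. -/
def inputFault : {P R : Type} → (c : Circuit O P R) → Pauli P → Fault c
  | _, _, wires _ _, p => p
  | _, _, step _ _ c, p => Sum.elim p (0 : Pauli (Loc c))

/-- The circuit with the Paulis of the fault `F` placed at the fault locations, as a linear map for
each assignment `k` of outcomes. -/
def eval : {P R : Type} → (c : Circuit O P R) → Fault c → Bits O → Matrix (Bits R) (Bits P) ℂ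
  | _, _, wires _ _, F, _ => pauliOp F
  | _, _, step _ g c, F, k =>
      eval c (fun l => F (Sum.inr l)) k * (g.op k * pauliOp (fun q => F (Sum.inl q)))

/-- The noise model: the atomic faults are the Paulis on a single noisy wire, and the faults of the
steps. -/
def noise : {P R : Type} → (c : Circuit O P R) → Set (Fault c)
  | _, _, wires _ noisy => {F | ∃ q ∈ noisy, ∃ p, p ≠ 0 ∧ F = Pi.single q p}
  | _, _, step noisy g c =>
      {F | ∃ q ∈ noisy, ∃ p, p ≠ 0 ∧ F = Sum.elim (Pi.single q p) (0 : Fault c)} ∪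
      {F | ∃ ab ∈ g.faults, F = Sum.elim ab.1 (inputFault c ab.2)} ∪
      {F | ∃ G ∈ noise c, F = Sum.elim (0 : Pauli _) G}

variable {P R : Type}

/-- The group of potential faults, generated by the atomic faults. -/
def faultGroup (c : Circuit O P R) : AddSubgroup (Fault c) := AddSubgroup.closure c.noise

/-- The weight of a potential fault: the least number of atomic faults whose product it is. -/
def weight (c : Circuit O P R) (F : Fault c) : ℕ :=
  sInf {n | ∃ l : List (Fault c), (∀ G ∈ l, G ∈ c.noise) ∧ l.sum = F ∧ l.length = n}

/-- `M` is a detecting set with parity `b`: in the fault-free circuit, all outcomes that can occur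
have parity `b` on `M`. -/
def IsDetectingSet (c : Circuit O P R) (M : Finset O) (b : ZMod 2) : Prop :=
  ∀ k, c.eval 0 k ≠ 0 → ∑ o ∈ M, k o = b

/-- A fault is detectable if it flips the parity of the outcomes in some detecting set. -/
def Detectable (c : Circuit O P R) (F : Fault c) : Prop :=
  ∃ M b, c.IsDetectingSet M b ∧ ∀ k, c.eval F k ≠ 0 → ∑ o ∈ M, k o = b + 1

end Circuit

/-- Equality of two families of linear maps, indexed by outcomes, when the outcomes `k` of the
first are computed from the outcomes `k'` of the second as `k = post k'`: each branch of the second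
equals the corresponding branch of the first up to a phase, and up to one normalisation `r` for the
whole family; and every outcome of the first that can occur is computed from some outcomes of the
second. -/
def SameMaps {O₁ O₂ P R : Type} (post : Bits O₂ → Bits O₁)
    (A : Bits O₁ → Matrix (Bits R) (Bits P) ℂ) (B : Bits O₂ → Matrix (Bits R) (Bits P) ℂ) : Prop :=
  (∃ r : ℝ, 0 < r ∧ ∀ k', ∃ u : ℂ, ‖u‖ = r ∧ B k' = u • A (post k')) ∧
    ∀ k, A k ≠ 0 → ∃ k', post k' = k

/-- `w`-fault equivalence of `c₁` and `c₂`, where `post` computes the outcomes of `c₁` from those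
of `c₂`. -/
def WFaultEquivalent {O₁ O₂ P R : Type} (w : ℕ) (c₁ : Circuit O₁ P R) (c₂ : Circuit O₂ P R)
    (post : Bits O₂ → Bits O₁) : Prop :=
  (∀ F₁ ∈ c₁.faultGroup, c₁.weight F₁ < w → c₁.Detectable F₁ ∨
    ∃ F₂ ∈ c₂.faultGroup, c₂.weight F₂ ≤ c₁.weight F₁ ∧
      SameMaps post (c₁.eval F₁) (c₂.eval F₂)) ∧
  (∀ F₂ ∈ c₂.faultGroup, c₂.weight F₂ < w → c₂.Detectable F₂ ∨
    ∃ F₁ ∈ c₁.faultGroup, c₁.weight F₁ ≤ c₂.weight F₂ ∧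
      SameMaps post (c₁.eval F₁) (c₂.eval F₂))

/-- Fault equivalence: `w`-fault equivalence for all `w`. -/
def FaultEquivalent {O₁ O₂ P R : Type} (c₁ : Circuit O₁ P R) (c₂ : Circuit O₂ P R)
    (post : Bits O₂ → Bits O₁) : Prop :=
  ∀ w, WFaultEquivalent w c₁ c₂ post

/-! ### CSS codes -/

/-- The two types of measurements and stabilisers. -/
inductive Kind
  | X
  | Z

/-- The Pauli of the given kind on the support `v`. -/
def Kind.pauli {Q : Type} : Kind → Bits Q → Pauli Q
  | .X, v => fun q => (v q, 0)
  | .Z, v => fun q => (0, v q)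

/-- A CSS stabiliser code on `n` qubits, given by stabilisers `S_1, …, S_m`, each of which is a
product of Pauli `X`s or a product of Pauli `Z`s, that commute with each other. -/
structure CSSCode (n m : ℕ) where
  kind : Fin m → Kind
  supp : Fin m → Bits (Fin n)
  commute : ∀ i j, PauliCommute ((kind i).pauli (supp i)) ((kind j).pauli (supp j))

namespace CSSCode

variable {n m : ℕ} (C : CSSCode n m)

/-- The stabiliser `S_i`. -/
def stab (i : Fin m) : Pauli (Fin n) := (C.kind i).pauli (C.supp i)

/-- The code space: the vectors that are fixed by all stabilisers. -/
def codeSpace : Set (Bits (Fin n) → ℂ) := {v | ∀ i, pauliOp (C.stab i) *ᵥ v = v}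

/-- `E` is an encoder of `κ` logical qubits: an injective linear map onto the code space. -/
def IsEncoder {κ : ℕ} (E : Matrix (Bits (Fin n)) (Bits (Fin κ)) ℂ) : Prop :=
  Function.Injective E.mulVec ∧ Set.range E.mulVec = C.codeSpace

/-- The distance: the least weight of a Pauli that commutes with all stabilisers without being a
product of stabilisers (`⊤` if there is none, that is, for codes without logical qubits). -/
def distance : ℕ∞ :=
  ⨅ p ∈ {p : Pauli (Fin n) | (∀ i, PauliCommute p (C.stab i)) ∧
    p ∉ AddSubgroup.closure (Set.range C.stab)}, (pauliWeight p : ℕ∞)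

/-- The supports of the products of `X`-stabilisers. -/
def xSpan : Submodule (ZMod 2) (Bits (Fin n)) :=
  Submodule.span (ZMod 2) {v | ∃ i, C.kind i = Kind.X ∧ C.supp i = v}

/-- The bit strings that satisfy all `Z`-stabilisers. Equivalently, the supports of the products of
`X`s that commute with all stabilisers, that is, of `X`-stabilisers and logical `X`s. -/
def zKer : Set (Bits (Fin n)) := {v | ∀ i, C.kind i = Kind.Z → C.supp i ⬝ᵥ v = 0}

open Classical in
/-- The logical `|0…0⟩`: the normalised sum of the basis vectors in `C.xSpan`. It is the state in
the code space that is fixed by all products of `Z`s that commute with the stabilisers, that is, by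
all logical `Z`s. -/
def logicalZero : Bits (Fin n) → ℂ :=
  fun v => if v ∈ C.xSpan then ((1 / √(Nat.card C.xSpan : ℝ) : ℝ) : ℂ) else 0

open Classical in
/-- The logical `|+…+⟩`: the normalised sum of the basis vectors in `C.zKer`. It is the state in
the code space that is fixed by all logical `X`s. -/
def logicalPlus : Bits (Fin n) → ℂ :=
  fun v => if v ∈ C.zKer then ((1 / √(Nat.card C.zKer : ℝ) : ℝ) : ℂ) else 0

end CSSCode

/-! ### The components of the circuits

Where there are two blocks of qubits, `Sum.inl j` is the `j`-th data qubit and `Sum.inr j` is the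
`j`-th qubit of the ancilla block. -/

section Gates

variable {O : Type} {n : ℕ}

/-- A fault-free encoder. -/
def encode {κ : ℕ} (E : Matrix (Bits (Fin n)) (Bits (Fin κ)) ℂ) : Gate O (Fin κ) (Fin n) where
  op _ := E
  faults := ∅

/-- A fault-free measurement of a Hermitian Pauli `p` whose outcome is labelled `o`: the projector
`(1 + (-1) ^ k * p) / 2`. -/
def measurePauli (p : Pauli (Fin n)) (o : O) : Gate O (Fin n) (Fin n) where
  op k := (1 / 2 : ℂ) • (1 + sgn (k o) • pauliOp p)
  faults := ∅

/-- Fault-free preparation of an ancilla block in the state `ψ`. -/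
def prepare (ψ : Bits (Fin n) → ℂ) : Gate O (Fin n) (Fin n ⊕ Fin n) where
  op _ := fun a b => if (fun j => a (Sum.inl j)) = b then ψ (fun j => a (Sum.inr j)) else 0
  faults := ∅

/-- The faults of a transversal CNOT: any non-trivial Pauli on the two outputs of one CNOT. -/
def cnotFaults (n : ℕ) : Set (Pauli (Fin n ⊕ Fin n) × Pauli (Fin n ⊕ Fin n)) :=
  {ab | ∃ (j : Fin n) (p r : ZMod 2 × ZMod 2), (p, r) ≠ 0 ∧
    ab = (0, Sum.elim (Pi.single j p) (Pi.single j r))}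

/-- Transversal CNOT with controls on the ancilla block and targets on the data. -/
def cnotToData : Gate O (Fin n ⊕ Fin n) (Fin n ⊕ Fin n) where
  op _ := fun a b =>
    if a = Sum.elim (fun j => b (Sum.inl j) + b (Sum.inr j)) (fun j => b (Sum.inr j)) then 1 else 0
  faults := cnotFaults n

/-- Transversal CNOT with controls on the data and targets on the ancilla block. -/
def cnotToAncilla : Gate O (Fin n ⊕ Fin n) (Fin n ⊕ Fin n) where
  op _ := fun a b =>
    if a = Sum.elim (fun j => b (Sum.inl j)) (fun j => b (Sum.inr j) + b (Sum.inl j)) then 1 else 0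
  faults := cnotFaults n

/-- The amplitude of the basis vector `b` in the outcome-`k` basis vector of the `X`-basis or of
the `Z`-basis of a qubit. -/
def Kind.amplitude : Kind → ZMod 2 → ZMod 2 → ℂ
  | .X, k, b => ((1 / √2 : ℝ) : ℂ) * sgn (k * b)
  | .Z, k, b => if k = b then 1 else 0

/-- Whether a single-qubit Pauli anticommutes with the Pauli of the given kind. -/
def Kind.Anticommutes : Kind → ZMod 2 × ZMod 2 → Prop
  | .X, p => p.2 = 1
  | .Z, p => p.1 = 1

/-- Destructive transversal measurement of the ancilla block in the basis of the given kind; the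
outcome of its `j`-th qubit is labelled `o j`. The gate faults are the measurement flips, that is,
an anticommuting Pauli before the measurement (there is no wire after it). -/
def measureAncilla (t : Kind) (o : Fin n → O) : Gate O (Fin n ⊕ Fin n) (Fin n) where
  op k := fun a b =>
    if (fun j => b (Sum.inl j)) = a then ∏ j, t.amplitude (k (o j)) (b (Sum.inr j)) else 0
  faults := {ab | ∃ (j : Fin n) (p : ZMod 2 × ZMod 2), t.Anticommutes p ∧
    ab = (Pi.single (Sum.inr j) p, 0)}

end Gates

/-! ### Ideal and Steane-style syndrome extraction -/

namespace CSSCode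

variable {n m κ : ℕ} (C : CSSCode n m)

/-- Fault-free measurements of the listed stabilisers, one after the other, with noisy output wires
and idealised wires between the measurements; `noisy` are the noisy input wires. -/
def measureList : Set (Fin n) → List (Fin m) → Circuit (Fin m) (Fin n) (Fin n)
  | _, [] => .wires (Fin n) Set.univ
  | noisy, i :: l => .step noisy (measurePauli (C.stab i) i) (measureList ∅ l)

/-- Ideal syndrome extraction on encoded data: after the fault-free encoder, the stabilisers
`S_1, …, S_m` are measured perfectly and without faults in between; only the data qubits before and
after all the measurements are noisy. -/
def idealExtraction (E : Matrix (Bits (Fin n)) (Bits (Fin κ)) ℂ) :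
    Circuit (Fin m) (Fin κ) (Fin n) :=
  .step ∅ (encode E) (C.measureList Set.univ (List.finRange m))

/-- Steane-style syndrome extraction on encoded data, under circuit-level noise except for the
fault-free encoder and the fault-free preparation of the logical states. -/
def steaneExtraction (E : Matrix (Bits (Fin n)) (Bits (Fin κ)) ℂ) :
    Circuit (Fin n ⊕ Fin n) (Fin κ) (Fin n) :=
  .step ∅ (encode E) <|
  .step Set.univ (prepare C.logicalZero) <|
  .step Set.univ cnotToData <|
  .step Set.univ (measureAncilla .X Sum.inl) <|
  .step Set.univ (prepare C.logicalPlus) <|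
  .step Set.univ cnotToAncilla <|
  .step Set.univ (measureAncilla .Z Sum.inr) <|
  .wires (Fin n) Set.univ

/-- The stabiliser outcomes computed from the transversal outcomes: the parity, over the support of
`S_i`, of the outcomes of the `X`-measured block if `S_i` is an `X`-stabiliser, and of the
`Z`-measured block if it is a `Z`-stabiliser. -/
def parities (k : Bits (Fin n ⊕ Fin n)) : Bits (Fin m) := fun i =>
  match C.kind i with
  | .X => ∑ j, C.supp i j * k (Sum.inl j)
  | .Z => ∑ j, C.supp i j * k (Sum.inr j)

end CSSCode

end FaultEq

end

noncomputable section
namespace FaultEq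

/-! ### Signs and Pauli operators -/

/-! Every gate after the encoder carries Paulis to Paulis, up to flips of outcomes, so a potential
fault `F` amounts to a Pauli `f F` on the output and a flip `t F` of the outcomes, both additive in
`F` (`Propagates.step`). Since all gates of the Steane circuit are transversal, an atomic fault ends
on at most one data qubit (`steane_propagates`), hence `f F` has weight at most `wt(F)`. Conversely,
an output Pauli `p` is itself a fault of weight at most that of `p`, and flips nothing.

Without faults, both circuits are a positive constant times `E` on the outcomes of zero syndrome and
`0` on all others. For the Steane circuit this holds because `E` is invariant under translations by
`xSpan` and supported on `zKer`.

`Extracts` records these facts, and `Extracts.faultEquivalent` needs no more. If `t F` has non-zero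
syndrome, a coordinate of the syndrome detects `F`. Otherwise the faulty circuit is, up to phase and
normalisation, `pauliOp (f F) * E` on zero syndrome, which depends on `f F` alone; the fault `f F`
on the output wires of the other circuit then matches `F`. The argument is the same in both
directions and at every weight. -/

theorem zmod_two_cases (a : ZMod 2) : a = 0 ∨ a = 1 := by revert a; decide

theorem sgn_zero : sgn 0 = 1 := by simp [sgn]

theorem sgn_add (a b : ZMod 2) : sgn (a + b) = sgn a * sgn b := by
  rcases zmod_two_cases a with rfl | rfl <;> rcases zmod_two_cases b with rfl | rfl <;>
    simp [sgn, CharTwo.add_self_eq_zero]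

theorem sgn_sum {ι : Type} (s : Finset ι) (f : ι → ZMod 2) :
    sgn (∑ i ∈ s, f i) = ∏ i ∈ s, sgn (f i) := by
  classical
  induction s using Finset.induction_on with
  | empty => simp [sgn_zero]
  | insert i s hi ih => rw [Finset.sum_insert hi, Finset.prod_insert hi, sgn_add, ih]

theorem norm_sgn (a : ZMod 2) : ‖sgn a‖ = 1 := by
  rcases zmod_two_cases a with rfl | rfl <;> simp [sgn]

theorem sgn_mul_self (a : ZMod 2) : sgn a * sgn a = 1 := by
  rw [← sgn_add, CharTwo.add_self_eq_zero, sgn_zero]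

theorem bits_add_self {L : Type} (a : Bits L) : a + a = 0 := funext fun _ => CharTwo.add_self_eq_zero _

theorem eq_add_iff_add_eq {L : Type} {a b c : Bits L} : a = b + c ↔ a + c = b := by
  constructor
  · rintro rfl; rw [add_assoc, bits_add_self, add_zero]
  · rintro rfl; rw [add_assoc, bits_add_self, add_zero]

section Pauli

variable {P Q : Type} [Fintype P] [DecidableEq P] [Fintype Q] [DecidableEq Q]

/-- The support of the `X`-part of a Pauli. -/
abbrev xPart {L : Type} (p : Pauli L) : Bits L := fun q => (p q).1

/-- The support of the `Z`-part of a Pauli. -/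
abbrev zPart {L : Type} (p : Pauli L) : Bits L := fun q => (p q).2

theorem pauliOp_apply (p : Pauli Q) (a b : Bits Q) :
    pauliOp p a b = if a = b + xPart p then sgn (zPart p ⬝ᵥ b) else 0 := rfl

theorem mul_pauliOp_apply {α : Type} (M : Matrix α (Bits Q) ℂ) (p : Pauli Q) (a : α) (b : Bits Q) :
    (M * pauliOp p) a b = M a (b + xPart p) * sgn (zPart p ⬝ᵥ b) := by
  simp [Matrix.mul_apply, pauliOp_apply]

theorem pauliOp_mul_apply {α : Type} (M : Matrix (Bits Q) α ℂ) (p : Pauli Q) (a : Bits Q) (b : α) :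
    (pauliOp p * M) a b = sgn (zPart p ⬝ᵥ (a + xPart p)) * M (a + xPart p) b := by
  simp [Matrix.mul_apply, pauliOp_apply, eq_add_iff_add_eq]

@[simp] theorem pauliOp_zero : pauliOp (0 : Pauli Q) = 1 := by
  ext a b
  have hx : xPart (0 : Pauli Q) = 0 := rfl
  have hz : zPart (0 : Pauli Q) = 0 := rfl
  simp [pauliOp_apply, hx, hz, sgn_zero, Matrix.one_apply]

theorem pauliOp_mul (p r : Pauli Q) :
    pauliOp p * pauliOp r = sgn (zPart p ⬝ᵥ xPart r) • pauliOp (p + r) := by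
  ext a b
  have hx : xPart (p + r) = xPart p + xPart r := rfl
  have hz : zPart (p + r) = zPart p + zPart r := rfl
  rw [mul_pauliOp_apply, Matrix.smul_apply, pauliOp_apply, pauliOp_apply, hx, hz,
    add_right_comm, add_assoc, smul_eq_mul]
  split_ifs with h
  · rw [dotProduct_add, add_dotProduct, sgn_add, sgn_add]; ring
  · simp

theorem pauliOp_mul_comm (p r : Pauli Q) :
    pauliOp p * pauliOp r =
      sgn (zPart p ⬝ᵥ xPart r + zPart r ⬝ᵥ xPart p) • (pauliOp r * pauliOp p) := by
  rw [pauliOp_mul, pauliOp_mul, smul_smul, sgn_add, mul_assoc, sgn_mul_self, mul_one, add_comm r]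

theorem pauliWeight_add_le (p r : Pauli Q) :
    pauliWeight (p + r) ≤ pauliWeight p + pauliWeight r := by
  unfold pauliWeight
  refine (Finset.card_le_card ?_).trans (Finset.card_union_le _ _)
  intro q
  simp only [Finset.mem_filter, Finset.mem_univ, true_and, Finset.mem_union, Pi.add_apply]
  contrapose!
  rintro ⟨h₁, h₂⟩
  simp [h₁, h₂]

theorem pauliWeight_single_le (q : Q) (p : ZMod 2 × ZMod 2) : pauliWeight (Pi.single q p) ≤ 1 := by
  unfold pauliWeight
  refine (Finset.card_le_card (t := {q}) ?_).trans (by simp)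
  intro r
  simp only [Finset.mem_filter, Finset.mem_univ, true_and, Finset.mem_singleton]
  contrapose!
  intro h
  simp [h]

end Pauli

/-! ### Propagation of faults to the output -/

/-- Paulis `p` before the gate `g`, which depends only on the outcomes in `A`, can be moved behind
it, where they become `φ p` and flips `τ p` of the outcomes. -/
structure Gate.Propagates {P Q : Type} [Fintype P] [DecidableEq P] [Fintype Q]
    [DecidableEq Q] (g : Gate O P Q) (A : Set O) (φ : Pauli P →+ Pauli Q) (τ : Pauli P →+ Bits O) :
    Prop where
  local_op : ∀ k k', (∀ o ∈ A, k o = k' o) → g.op k = g.op k'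
  flips : ∀ p, ∀ o ∉ A, τ p o = 0
  push : ∀ p k, ∃ b, g.op k * pauliOp p = sgn b • (pauliOp (φ p) * g.op (k + τ p))

namespace Circuit

variable {O : Type}

/-- The fault that acts as `p` on the output wires and trivially elsewhere. -/
def outputFault : {P R : Type} → (c : Circuit O P R) → Pauli R → Fault c
  | _, _, wires _ _, p => p
  | _, _, step _ _ c, p => Sum.elim (0 : Pauli _) (outputFault c p)

theorem inputFault_add {P R : Type} (c : Circuit O P R) (p r : Pauli P) :
    inputFault c (p + r) = inputFault c p + inputFault c r := by
  cases c with
  | wires => rfl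
  | step noisy g c =>
    funext l
    rcases l with l | l
    · rfl
    · exact (add_zero (0 : ZMod 2 × ZMod 2)).symm

/-- `inputFault` as a homomorphism. -/
def inputFaultHom {P R : Type} (c : Circuit O P R) : Pauli P →+ Fault c :=
  AddMonoidHom.mk' (inputFault c) (inputFault_add c)

theorem outputFault_add {P R : Type} (c : Circuit O P R) (p r : Pauli R) :
    outputFault c (p + r) = outputFault c p + outputFault c r := by
  induction c with
  | wires => rfl
  | step noisy g c ih =>
    funext l
    rcases l with l | l
    · exact (add_zero (0 : ZMod 2 × ZMod 2)).symm
    · exact congrFun (ih p r) l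

/-- `outputFault` as a homomorphism. -/
def outputFaultHom {P R : Type} (c : Circuit O P R) : Pauli R →+ Fault c :=
  AddMonoidHom.mk' (outputFault c) (outputFault_add c)

/-- A Pauli after the preceding steps merges with the fault on the input wires. -/
theorem eval_mul_pauliOp {P R : Type} [Fintype P] [DecidableEq P] (c : Circuit O P R)
    (F : Fault c) (k : Bits O) (p : Pauli P) :
    ∃ b, c.eval F k * pauliOp p = sgn b • c.eval (F + inputFault c p) k := by
  cases c with
  | @wires _ i₃ i₄ noisy =>
    rename_i i₁ i₂
    -- The constructor carries its own instances on the register; they must be identified with those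
    -- of the statement before Paulis can be multiplied.
    obtain rfl : i₁ = i₃ := Subsingleton.elim _ _
    obtain rfl : i₂ = i₄ := Subsingleton.elim _ _
    exact ⟨_, pauliOp_mul (Q := P) F p⟩
  | @step _ Q _ i₃ i₄ i₅ i₆ noisy g c =>
    rename_i i₁ i₂
    obtain rfl : i₁ = i₃ := Subsingleton.elim _ _
    obtain rfl : i₂ = i₄ := Subsingleton.elim _ _
    refine ⟨zPart (fun q => F (Sum.inl q)) ⬝ᵥ xPart p, ?_⟩
    have h : (fun l => (F + inputFault (step noisy g c) p) (Sum.inr l)) =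
        fun l => F (Sum.inr l) := by
      funext l; exact add_zero (F (Sum.inr l))
    change c.eval (fun l => F (Sum.inr l)) k * (g.op k * pauliOp (fun q => F (Sum.inl q))) *
      pauliOp p = _ • (c.eval (fun l => (F + inputFault (step noisy g c) p) (Sum.inr l)) k *
        (g.op k * pauliOp ((fun q => F (Sum.inl q)) + p)))
    rw [h, Matrix.mul_assoc, Matrix.mul_assoc, pauliOp_mul, Matrix.mul_smul, Matrix.mul_smul]

/-- The restriction of a fault of `step noisy g c` to the input wires. -/
def headHom {P Q R : Type} [Fintype P] [DecidableEq P] [Fintype Q] [DecidableEq Q]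
    (noisy : Set P) (g : Gate O P Q) (c : Circuit O Q R) : Fault (step noisy g c) →+ Pauli P :=
  AddMonoidHom.mk' (fun F q => F (Sum.inl q)) fun _ _ => rfl

/-- The restriction of a fault of `step noisy g c` to `c`. -/
def tailHom {P Q R : Type} [Fintype P] [DecidableEq P] [Fintype Q] [DecidableEq Q]
    (noisy : Set P) (g : Gate O P Q) (c : Circuit O Q R) : Fault (step noisy g c) →+ Fault c :=
  AddMonoidHom.mk' (fun F l => F (Sum.inr l)) fun _ _ => rfl

/-- All faults of `c`, which depends only on the outcomes in `D`, can be pushed to the output: the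
fault `F` amounts to the output Pauli `f F` and to flips `t F` of the outcomes. Atomic faults become
Paulis of weight at most one, and the Paulis on single output wires are atomic faults. -/
structure Propagates {P R : Type} [Fintype R] [DecidableEq R] (c : Circuit O P R) (D : Set O)
    (f : Fault c →+ Pauli R) (t : Fault c →+ Bits O) : Prop where
  local_eval : ∀ F k k', (∀ o ∈ D, k o = k' o) → c.eval F k = c.eval F k'
  flips : ∀ F, ∀ o ∉ D, t F o = 0
  push : ∀ F k, ∃ b, c.eval F k = sgn b • (pauliOp (f F) * c.eval 0 (k + t F))
  weight_le : ∀ G ∈ c.noise, pauliWeight (f G) ≤ 1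
  output : ∀ p, f (outputFault c p) = p
  output_flips : ∀ p, t (outputFault c p) = 0
  output_noise : ∀ q p, p ≠ 0 → outputFault c (Pi.single q p) ∈ c.noise

theorem Propagates.wires {R : Type} [Fintype R] [DecidableEq R] :
    Propagates (O := O) (.wires R Set.univ) ∅ (.id _) 0 where
  local_eval _ _ _ _ := rfl
  flips _ _ _ := rfl
  push F k := ⟨0, by
    change pauliOp (Q := R) F = sgn 0 • (pauliOp (Q := R) F * pauliOp 0)
    rw [pauliOp_zero, Matrix.mul_one, sgn_zero, one_smul]⟩
  weight_le := by
    rintro G ⟨q, -, p, -, rfl⟩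
    exact pauliWeight_single_le q p
  output _ := rfl
  output_flips _ := rfl
  output_noise q p hp := ⟨q, trivial, p, hp, rfl⟩

/-- A Pauli `p` on the input wires passes the gate as `φ p`, merges with the fault of `c` on its
first wires, and travels on through `c`; this explains the shape of the two composite homomorphisms.
Disjointness of `A` and `D` keeps the flips of the gate and those of `c` from interfering. -/
theorem Propagates.step {P Q R : Type} [Fintype P] [DecidableEq P] [Fintype Q] [DecidableEq Q]
    [Fintype R] [DecidableEq R] {noisy : Set P} {g : Gate O P Q} {c : Circuit O Q R} {A D : Set O}
    {φ : Pauli P →+ Pauli Q} {τ : Pauli P →+ Bits O} {f : Fault c →+ Pauli R}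
    {t : Fault c →+ Bits O} (hc : c.Propagates D f t) (hg : g.Propagates A φ τ)
    (hAD : Disjoint A D)
    (hnoisy : ∀ q ∈ noisy, ∀ p, pauliWeight (f (inputFault c (φ (Pi.single q p)))) ≤ 1)
    (hfaults : ∀ ab ∈ g.faults, pauliWeight (f (inputFault c (φ ab.1 + ab.2))) ≤ 1) :
    Propagates (.step noisy g c) (A ∪ D)
      (f.comp (tailHom noisy g c + (inputFaultHom c).comp (φ.comp (headHom noisy g c))))
      (t.comp (tailHom noisy g c + (inputFaultHom c).comp (φ.comp (headHom noisy g c))) +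
        τ.comp (headHom noisy g c)) where
  local_eval F k k' h := by
    change c.eval _ k * (g.op k * _) = c.eval _ k' * (g.op k' * _)
    rw [hc.local_eval _ k k' fun o ho => h o (.inr ho), hg.local_op k k' fun o ho => h o (.inl ho)]
  flips F o ho := by
    have h₁ := hc.flips (tailHom noisy g c F + inputFault c (φ (headHom noisy g c F))) o
      fun h => ho (.inr h)
    have h₂ := hg.flips (headHom noisy g c F) o fun h => ho (.inl h)
    exact (congrArg₂ (· + ·) h₁ h₂).trans (add_zero 0)
  push F k := by
    set p := headHom noisy g c F
    set G := tailHom noisy g c F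
    obtain ⟨b₁, h₁⟩ := hg.push p k
    obtain ⟨b₂, h₂⟩ := eval_mul_pauliOp c G k (φ p)
    obtain ⟨b₃, h₃⟩ := hc.push (G + inputFault c (φ p)) k
    refine ⟨b₁ + b₂ + b₃, ?_⟩
    change c.eval G k * (g.op k * pauliOp p) = _ • (pauliOp (f (G + inputFault c (φ p))) *
      (c.eval 0 (k + (t (G + inputFault c (φ p)) + τ p)) *
        (g.op (k + (t (G + inputFault c (φ p)) + τ p)) * pauliOp 0)))
    have e₁ : c.eval 0 (k + (t (G + inputFault c (φ p)) + τ p)) =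
        c.eval 0 (k + t (G + inputFault c (φ p))) := by
      refine hc.local_eval _ _ _ fun o ho => ?_
      simp [hg.flips p o fun h => Set.disjoint_left.1 hAD h ho]
    have e₂ : g.op (k + (t (G + inputFault c (φ p)) + τ p)) = g.op (k + τ p) := by
      refine hg.local_op _ _ fun o ho => ?_
      rw [Pi.add_apply, Pi.add_apply, Pi.add_apply,
        hc.flips (G + inputFault c (φ p)) o fun h => Set.disjoint_left.1 hAD ho h, zero_add]
    rw [e₁, e₂, pauliOp_zero, Matrix.mul_one, h₁, Matrix.mul_smul, ← Matrix.mul_assoc, h₂, h₃,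
      smul_smul, Matrix.smul_mul, smul_smul, sgn_add, sgn_add, Matrix.mul_assoc, mul_assoc]
  weight_le := by
    rintro G ((⟨q, hq, p, -, rfl⟩ | ⟨ab, hab, rfl⟩) | ⟨G, hG, rfl⟩)
    · have h := hnoisy q hq p
      -- On a fault with trivial tail the composite unfolds to `f (0 + inputFault c _)`; padding
      -- with zero makes the two sides agree definitionally. The other fields use the same device.
      rw [← zero_add (inputFault c _)] at h
      exact h
    · have h := hfaults ab hab
      rw [add_comm, inputFault_add] at h
      exact h
    · have h := hc.weight_le G hG
      rw [← add_zero G, ← (inputFaultHom c).map_zero, ← φ.map_zero] at h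
      exact h
  output p := by
    have h := hc.output p
    rw [← add_zero (outputFault c p), ← (inputFaultHom c).map_zero, ← φ.map_zero] at h
    exact h
  output_flips p := by
    have h := hc.output_flips p
    rw [← add_zero (outputFault c p), ← (inputFaultHom c).map_zero, ← φ.map_zero] at h
    exact (congrArg₂ (· + ·) h τ.map_zero).trans (add_zero 0)
  output_noise q p hp := .inr ⟨_, hc.output_noise q p hp, rfl⟩

end Circuit

/-! ### Propagation through the gates -/

section Gates

variable {O : Type} {n : ℕ}

/-- Moving `p` past `s` costs a sign, the symplectic product of the two. In the projector for `s`
this sign is absorbed by changing the outcome. -/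
theorem measurePauli_propagates [DecidableEq O] (s : Pauli (Fin n)) (o : O) :
    (measurePauli s o).Propagates {o} (.id _)
      (AddMonoidHom.mk' (fun p => Pi.single o (zPart s ⬝ᵥ xPart p + zPart p ⬝ᵥ xPart s))
        fun p r => by
          have hx : xPart (p + r) = xPart p + xPart r := rfl
          have hz : zPart (p + r) = zPart p + zPart r := rfl
          rw [hx, hz, dotProduct_add, add_dotProduct, ← Pi.single_add]
          congr 1
          ring) where
  local_op k k' h := by
    simp only [measurePauli, h o rfl]
  flips p o' h := Pi.single_eq_of_ne h _
  push p k := ⟨0, by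
    simp only [measurePauli, AddMonoidHom.id_apply, AddMonoidHom.mk'_apply, Pi.add_apply,
      Pi.single_eq_same, sgn_zero, one_smul, Matrix.smul_mul, Matrix.mul_smul, Matrix.add_mul,
      Matrix.mul_add, Matrix.one_mul, Matrix.mul_one]
    rw [pauliOp_mul_comm s p, smul_smul, sgn_add (k o)]⟩

/-- Propagation of Paulis through the preparation of an ancilla block. -/
def prepareHom (n : ℕ) : Pauli (Fin n) →+ Pauli (Fin n ⊕ Fin n) :=
  AddMonoidHom.mk' (fun p => Sum.elim p (0 : Pauli (Fin n))) fun p r => by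
    funext q; rcases q with q | q <;> simp

theorem prepare_propagates (ψ : Bits (Fin n) → ℂ) :
    (prepare ψ : Gate O _ _).Propagates ∅ (prepareHom n) 0 where
  local_op _ _ _ := rfl
  flips _ _ _ := rfl
  push p k := ⟨0, by
    ext a b
    have hx : xPart (prepareHom n p) = Sum.elim (xPart p) 0 := by
      funext q; rcases q with q | q <;> rfl
    have hz : zPart (prepareHom n p) = Sum.elim (zPart p) 0 := by
      funext q; rcases q with q | q <;> rfl
    rw [sgn_zero, one_smul, mul_pauliOp_apply, pauliOp_mul_apply, hx, hz]
    simp only [prepare, dotProduct, Fintype.sum_sum_type, Sum.elim_inl,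
      Sum.elim_inr, Pi.add_apply, Pi.zero_apply, zero_mul,
      Finset.sum_const_zero, add_zero, mul_ite, ite_mul, mul_zero]
    refine ite_congr (propext eq_add_iff_add_eq) (fun h => ?_) fun _ => rfl
    have h' : ∀ j, a (Sum.inl j) + xPart p j = b j := congrFun h
    simp only [h', mul_comm]⟩

/-- Propagation of Paulis through the transversal CNOT with targets on the data. -/
def cnotToDataHom (n : ℕ) : Pauli (Fin n ⊕ Fin n) →+ Pauli (Fin n ⊕ Fin n) :=
  AddMonoidHom.mk' (fun p => Sum.elim
      (fun j => ((p (.inl j)).1 + (p (.inr j)).1, (p (.inl j)).2))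
      (fun j => ((p (.inr j)).1, (p (.inr j)).2 + (p (.inl j)).2))) fun p r => by
    funext q; rcases q with q | q <;> ext <;> simp <;> ring

theorem cnotToData_propagates :
    (cnotToData : Gate O (Fin n ⊕ Fin n) _).Propagates ∅ (cnotToDataHom n) 0 where
  local_op _ _ _ := rfl
  flips _ _ _ := rfl
  push p k := ⟨0, by
    ext a b
    have hx : xPart (cnotToDataHom n p) = Sum.elim (fun j => xPart p (.inl j) + xPart p (.inr j))
        (fun j => xPart p (.inr j)) := by
      funext q; rcases q with q | q <;> rfl
    have hz : zPart (cnotToDataHom n p) = Sum.elim (fun j => zPart p (.inl j))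
        (fun j => zPart p (.inr j) + zPart p (.inl j)) := by
      funext q; rcases q with q | q <;> rfl
    rw [sgn_zero, one_smul, mul_pauliOp_apply, pauliOp_mul_apply, hx, hz]
    simp only [cnotToData, mul_ite, ite_mul, mul_zero, zero_mul, one_mul, mul_one]
    refine ite_congr ?_ (fun h => ?_) fun _ => rfl
    · rw [← eq_add_iff_add_eq]
      congr 1
      funext q; rcases q with q | q <;> simp; ring
    · rw [h]
      simp only [dotProduct, Fintype.sum_sum_type, Sum.elim_inl, Sum.elim_inr,
        ← Finset.sum_add_distrib]
      congr 1
      refine Finset.sum_congr rfl fun j _ => ?_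
      -- The product of the data `Z` part and the ancilla bit occurs twice, so it cancels modulo 2.
      linear_combination
        (-zPart p (.inl j) * b (.inr j)) * (CharTwo.two_eq_zero (R := ZMod 2))⟩

/-- Propagation of Paulis through the transversal CNOT with targets on the ancilla block. -/
def cnotToAncillaHom (n : ℕ) : Pauli (Fin n ⊕ Fin n) →+ Pauli (Fin n ⊕ Fin n) :=
  AddMonoidHom.mk' (fun p => Sum.elim
      (fun j => ((p (.inl j)).1, (p (.inl j)).2 + (p (.inr j)).2))
      (fun j => ((p (.inr j)).1 + (p (.inl j)).1, (p (.inr j)).2))) fun p r => by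
    funext q; rcases q with q | q <;> ext <;> simp <;> ring

theorem cnotToAncilla_propagates :
    (cnotToAncilla : Gate O (Fin n ⊕ Fin n) _).Propagates ∅ (cnotToAncillaHom n) 0 where
  local_op _ _ _ := rfl
  flips _ _ _ := rfl
  push p k := ⟨0, by
    ext a b
    have hx : xPart (cnotToAncillaHom n p) = Sum.elim (fun j => xPart p (.inl j))
        (fun j => xPart p (.inr j) + xPart p (.inl j)) := by
      funext q; rcases q with q | q <;> rfl
    have hz : zPart (cnotToAncillaHom n p) = Sum.elim
        (fun j => zPart p (.inl j) + zPart p (.inr j)) (fun j => zPart p (.inr j)) := by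
      funext q; rcases q with q | q <;> rfl
    rw [sgn_zero, one_smul, mul_pauliOp_apply, pauliOp_mul_apply, hx, hz]
    simp only [cnotToAncilla, mul_ite, ite_mul, mul_zero, zero_mul, one_mul, mul_one]
    refine ite_congr ?_ (fun h => ?_) fun _ => rfl
    · rw [← eq_add_iff_add_eq]
      congr 1
      funext q; rcases q with q | q <;> simp; ring
    · rw [h]
      simp only [dotProduct, Fintype.sum_sum_type, Sum.elim_inl, Sum.elim_inr,
        ← Finset.sum_add_distrib]
      congr 1
      refine Finset.sum_congr rfl fun j _ => ?_
      linear_combination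
        (-zPart p (.inr j) * b (.inl j)) * (CharTwo.two_eq_zero (R := ZMod 2))⟩

/-- The part of a single-qubit Pauli that flips the outcome of a measurement of the given kind. -/
def Kind.flip : Kind → ZMod 2 × ZMod 2 → ZMod 2
  | .X, p => p.2
  | .Z, p => p.1

/-- The part of the Pauli that commutes with the measured basis only yields a sign. That sign must
not depend on `b`, so that it can be pulled out of the matrix; in the `Z` basis this works because a
non-zero amplitude forces `b = k + p.1`. -/
theorem Kind.amplitude_add (t : Kind) (p : ZMod 2 × ZMod 2) (k : ZMod 2) :
    ∃ e, ∀ b, t.amplitude k (b + p.1) * sgn (p.2 * b) = sgn e * t.amplitude (k + t.flip p) b := by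
  cases t with
  | X =>
    refine ⟨k * p.1, fun b => ?_⟩
    simp only [Kind.amplitude, Kind.flip, mul_add, add_mul, sgn_add]
    ring
  | Z =>
    refine ⟨p.2 * (k + p.1), fun b => ?_⟩
    have hf : Kind.Z.flip p = p.1 := rfl
    simp only [Kind.amplitude, hf]
    have h : k = b + p.1 ↔ k + p.1 = b := by
      generalize p.1 = x; revert k b x; decide
    by_cases hk : k + p.1 = b
    · rw [if_pos hk, if_pos (h.2 hk), hk, one_mul, mul_one]
    · rw [if_neg hk, if_neg (mt h.1 hk), zero_mul, mul_zero]

/-- Propagation of Paulis through the measurement of the ancilla block. -/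
def dataHom (n : ℕ) : Pauli (Fin n ⊕ Fin n) →+ Pauli (Fin n) :=
  AddMonoidHom.mk' (fun p j => p (.inl j)) fun _ _ => rfl

/-- The qubits are independent, so their signs `e j` multiply. As `o` need not be injective, the
flip map `τ` is a parameter. -/
theorem measureAncilla_propagates (t : Kind) (o : Fin n → O) (τ : Pauli (Fin n ⊕ Fin n) →+ Bits O)
    (hτ : ∀ p j, τ p (o j) = t.flip (p (.inr j))) (hτ' : ∀ p, ∀ i ∉ Set.range o, τ p i = 0) :
    (measureAncilla t o).Propagates (Set.range o) (dataHom n) τ where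
  local_op k k' h := by
    ext a b
    simp only [measureAncilla, h _ (Set.mem_range_self _)]
  flips := hτ'
  push p k := by
    choose e he using fun j => t.amplitude_add (p (.inr j)) (k (o j))
    refine ⟨∑ j, e j, ?_⟩
    ext a b
    have hx : xPart (dataHom n p) = fun j => xPart p (.inl j) := rfl
    have hz : zPart (dataHom n p) = fun j => zPart p (.inl j) := rfl
    rw [Matrix.smul_apply, mul_pauliOp_apply, pauliOp_mul_apply, hx, hz]
    simp only [measureAncilla, mul_ite, ite_mul, mul_zero, zero_mul, smul_eq_mul]
    have hiff : ((fun j => (b + xPart p) (Sum.inl j)) = a) =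
        ((fun j => b (Sum.inl j)) = a + fun j => xPart p (.inl j)) :=
      propext eq_add_iff_add_eq.symm
    refine ite_congr hiff (fun h => ?_) fun _ => rfl
    have hd : sgn (zPart p ⬝ᵥ b) = sgn (∑ j, zPart p (.inl j) * b (.inl j)) *
        sgn (∑ j, zPart p (.inr j) * b (.inr j)) := by
      rw [← sgn_add]
      simp only [dotProduct, Fintype.sum_sum_type]
    have hp := Finset.prod_congr rfl fun (j : Fin n) (_ : j ∈ Finset.univ) => he j (b (.inr j))
    rw [Finset.prod_mul_distrib, Finset.prod_mul_distrib, ← sgn_sum, ← sgn_sum] at hp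
    rw [hd, ← h]
    simp only [Pi.add_apply, hτ, dotProduct]
    linear_combination sgn (∑ j, zPart p (.inl j) * b (.inl j)) * hp

end Gates

/-! ### Building propagation gate by gate -/

namespace Circuit

variable {O P Q R : Type} [Fintype P] [DecidableEq P] [Fintype Q] [DecidableEq Q]
  [Fintype R] [DecidableEq R]

/-- Faults of `c` propagate to the output, and those on the input wires do so by `ι`. -/
def PropagatesBy (c : Circuit O P R) (D : Set O) (ι : Pauli P → Pauli R) : Prop :=
  ∃ f t, c.Propagates D f t ∧ ∀ p, f (inputFault c p) = ι p

theorem PropagatesBy.wires :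
    PropagatesBy (O := O) (.wires R Set.univ) ∅ id :=
  ⟨_, _, .wires, fun _ => rfl⟩

/-- With `f` and `t` hidden, only the action `ι` on the input wires is left to track, and it is all
that the weight checks for the preceding gate require. -/
theorem PropagatesBy.step {noisy : Set P} {g : Gate O P Q} {c : Circuit O Q R} {A D : Set O}
    {φ : Pauli P →+ Pauli Q} {τ : Pauli P →+ Bits O} {ι : Pauli Q → Pauli R}
    (hc : c.PropagatesBy D ι) (hg : g.Propagates A φ τ) (hAD : Disjoint A D)
    (hnoisy : ∀ q ∈ noisy, ∀ p, pauliWeight (ι (φ (Pi.single q p))) ≤ 1)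
    (hfaults : ∀ ab ∈ g.faults, pauliWeight (ι (φ ab.1 + ab.2)) ≤ 1) :
    PropagatesBy (.step noisy g c) (A ∪ D) (ι ∘ φ) := by
  obtain ⟨f, t, h, hι⟩ := hc
  refine ⟨_, _, h.step hg hAD (fun q hq p => ?_) (fun ab hab => ?_), fun p => ?_⟩
  · rw [hι]; exact hnoisy q hq p
  · rw [hι]; exact hfaults ab hab
  · have e : f (0 + inputFault c (φ p)) = ι (φ p) := by rw [zero_add, hι]
    exact e

end Circuit

/-! ### Fault equivalence of syndrome extraction circuits -/

namespace Circuit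

variable {O P R S : Type} [Fintype S] [Fintype R] [DecidableEq R]

/-- Up to detectable faults, `c` amounts to the linear map `E` followed by a noise channel on the
outputs: `c` extracts the syndrome `syn` of the outcomes. -/
structure Extracts [Fintype O] (c : Circuit O P R) (E : Matrix (Bits R) (Bits P) ℂ)
    (syn : Bits O → Bits S) (f : Fault c →+ Pauli R) (t : Fault c →+ Bits O) : Prop where
  push : ∀ F ∈ c.faultGroup, ∀ k, ∃ b, c.eval F k = sgn b • (pauliOp (f F) * c.eval 0 (k + t F))
  eval_zero : ∃ r : ℝ, 0 < r ∧ ∀ k, c.eval 0 k = if syn k = 0 then (r : ℂ) • E else 0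
  parity : ∀ i, ∃ a : Bits O, ∀ k, syn k i = a ⬝ᵥ k
  weight_le : ∀ G ∈ c.noise, pauliWeight (f G) ≤ 1
  output : ∀ p, f (outputFault c p) = p
  output_flips : ∀ p, t (outputFault c p) = 0
  output_noise : ∀ q p, p ≠ 0 → outputFault c (Pi.single q p) ∈ c.noise

/-- An arbitrary encoder need not map Paulis to Paulis. It need not be crossed, though: its input
wires are noiseless and it has no faults, so only faults of `c` remain. -/
theorem Extracts.of_propagates [Fintype P] [DecidableEq P] [Fintype O] {c : Circuit O R R} {D : Set O} {ι : Pauli R → Pauli R}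
    (hc : c.PropagatesBy D ι) {g : Gate O P R} (hg : g.faults = ∅)
    {E : Matrix (Bits R) (Bits P) ℂ} {syn : Bits O → Bits S}
    (h0 : ∃ r : ℝ, 0 < r ∧ ∀ k, c.eval 0 k * g.op k = if syn k = 0 then (r : ℂ) • E else 0)
    (hop : ∀ k k', g.op k = g.op k') (hpar : ∀ i, ∃ a : Bits O, ∀ k, syn k i = a ⬝ᵥ k) :
    ∃ f t, Extracts (.step ∅ g c) E syn f t := by
  obtain ⟨f, t, h, -⟩ := hc
  have hz : ∀ k, (Circuit.step ∅ g c).eval 0 k = c.eval 0 k * g.op k := fun k => by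
    change c.eval 0 k * (g.op k * pauliOp 0) = _
    rw [pauliOp_zero, Matrix.mul_one]
  refine ⟨f.comp (tailHom ∅ g c), t.comp (tailHom ∅ g c), ?_, ?_, hpar, ?_, h.output,
    h.output_flips, fun q p hp => .inr ⟨_, h.output_noise q p hp, rfl⟩⟩
  · intro F hF k
    -- All generators, hence all potential faults, are trivial on the input wires.
    have hle : (Circuit.step ∅ g c).faultGroup ≤ (headHom ∅ g c).ker := by
      refine (AddSubgroup.closure_le _).2 ?_
      rintro G ((⟨q, hq, -⟩ | ⟨ab, hab, -⟩) | ⟨G, -, rfl⟩)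
      · exact hq.elim
      · rw [hg] at hab; exact hab.elim
      · rfl
    have h₀ : headHom ∅ g c F = 0 := hle hF
    obtain ⟨b, hb⟩ := h.push (tailHom ∅ g c F) k
    refine ⟨b, ?_⟩
    rw [hz]
    change c.eval (tailHom ∅ g c F) k * (g.op k * pauliOp (headHom ∅ g c F)) = _
    rw [h₀, pauliOp_zero, Matrix.mul_one, hb, Matrix.smul_mul, Matrix.mul_assoc,
      hop k (k + (t.comp (tailHom ∅ g c)) F)]
    rfl
  · simpa only [hz] using h0
  · rintro G ((⟨q, hq, -⟩ | ⟨ab, hab, -⟩) | ⟨G, hG, rfl⟩)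
    · exact hq.elim
    · rw [hg] at hab; exact hab.elim
    · exact h.weight_le G hG

theorem neg_fault {L : Type} (F : Pauli L) : -F = F := by
  funext l
  ext <;> exact CharTwo.neg_eq _

/-- A potential fault is a product of as many atomic faults as its weight says. -/
theorem exists_list_of_mem_faultGroup {P R : Type} {c : Circuit O P R} {F : Fault c} (hF : F ∈ c.faultGroup) :
    ∃ l : List (Fault c), (∀ G ∈ l, G ∈ c.noise) ∧ l.sum = F ∧ l.length = c.weight F := by
  -- On `ℕ` the infimum of the empty set is `0`, so a decomposition into atomic faults must be
  -- exhibited. Inverses cause no trouble: every fault is its own inverse.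
  refine Nat.sInf_mem
    (s := {n | ∃ l : List (Fault c), (∀ G ∈ l, G ∈ c.noise) ∧ l.sum = F ∧ l.length = n}) ?_
  refine AddSubgroup.closure_induction
    (p := fun F _ => {n | ∃ l : List (Fault c), (∀ G ∈ l, G ∈ c.noise) ∧ l.sum = F ∧
      l.length = n}.Nonempty) (fun G hG => ⟨1, [G], by simpa using hG, by simp, rfl⟩)
    ⟨0, [], by simp, rfl, rfl⟩ ?_ (fun G _ h => by rwa [neg_fault]) hF
  rintro _ _ - - ⟨_, l, hl, rfl, -⟩ ⟨_, l', hl', rfl, -⟩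
  refine ⟨_, l ++ l', fun G hG => ?_, List.sum_append, rfl⟩
  exact (List.mem_append.1 hG).elim (hl G) (hl' G)

theorem pauliWeight_list_sum_le (l : List (Pauli R)) (h : ∀ p ∈ l, pauliWeight p ≤ 1) :
    pauliWeight l.sum ≤ l.length := by
  induction l with
  | nil => simp [pauliWeight]
  | cons p l ih =>
    rw [List.sum_cons, List.length_cons, add_comm l.length]
    exact (pauliWeight_add_le _ _).trans
      (add_le_add (h p (by simp)) (ih fun r hr => h r (by simp [hr])))

/-- Apply `f` to a shortest decomposition of `F`: each factor contributes weight at most one. -/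
theorem Extracts.pauliWeight_le [Fintype O] {c : Circuit O P R} {E : Matrix (Bits R) (Bits P) ℂ}
    {syn : Bits O → Bits S} {f : Fault c →+ Pauli R} {t : Fault c →+ Bits O}
    (h : c.Extracts E syn f t) {F : Fault c} (hF : F ∈ c.faultGroup) :
    pauliWeight (f F) ≤ c.weight F := by
  obtain ⟨l, hl, rfl, hw⟩ := exists_list_of_mem_faultGroup hF
  rw [← hw, map_list_sum, ← List.length_map (as := l) f]
  refine pauliWeight_list_sum_le _ fun p hp => ?_
  obtain ⟨G, hG, rfl⟩ := List.mem_map.1 hp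
  exact h.weight_le G (hl G hG)

/-- Split `p` into its single-qubit factors, each of which is an atomic fault on the output wires.
-/
theorem Extracts.outputFault_mem [Fintype O] {c : Circuit O P R} {E : Matrix (Bits R) (Bits P) ℂ}
    {syn : Bits O → Bits S} {f : Fault c →+ Pauli R} {t : Fault c →+ Bits O}
    (h : c.Extracts E syn f t) (p : Pauli R) :
    outputFault c p ∈ c.faultGroup ∧ c.weight (outputFault c p) ≤ pauliWeight p := by
  set l : List (Fault c) := ((Finset.univ.filter fun q => p q ≠ 0).toList.map
    fun q => outputFault c (Pi.single q (p q))) with hl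
  have hmem : ∀ G ∈ l, G ∈ c.noise := by
    intro G hG
    obtain ⟨q, hq, rfl⟩ := List.mem_map.1 hG
    exact h.output_noise q _ (by simpa using hq)
  have hsum : l.sum = outputFault c p := by
    rw [hl, Finset.sum_map_toList]
    change ∑ q ∈ _, outputFaultHom c _ = outputFaultHom c p
    rw [← map_sum]
    congr 1
    rw [Finset.sum_filter_of_ne fun q _ hq => by
      contrapose! hq; rw [hq, Pi.single_zero]]
    exact Finset.univ_sum_single p
  refine ⟨?_, Nat.sInf_le ⟨l, hmem, hsum, by simp [hl, pauliWeight]⟩⟩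
  rw [← hsum]
  exact list_sum_mem fun G hG => AddSubgroup.subset_closure (hmem G hG)

theorem sum_filter_eq_dotProduct [Fintype O] (a k : Bits O) :
    ∑ o ∈ Finset.univ.filter (fun o => a o = 1), k o = a ⬝ᵥ k := by
  rw [Finset.sum_filter, dotProduct]
  refine Finset.sum_congr rfl fun o _ => ?_
  rcases zmod_two_cases (a o) with h | h <;> simp [h]

/-- A coordinate of the syndrome is a linear functional `a` of the outcomes. It vanishes on all
outcomes of the fault-free circuit, so the support of `a` is a detecting set, and `F` flips its
parity if `a ⬝ᵥ t F = 1`. -/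
theorem Extracts.detectable [Fintype O] {c : Circuit O P R} {E : Matrix (Bits R) (Bits P) ℂ}
    {syn : Bits O → Bits S} {f : Fault c →+ Pauli R} {t : Fault c →+ Bits O}
    (h : c.Extracts E syn f t) {F : Fault c} (hF : F ∈ c.faultGroup) (hs : syn (t F) ≠ 0) :
    c.Detectable F := by
  obtain ⟨i, hi⟩ := Function.ne_iff.1 hs
  obtain ⟨a, ha⟩ := h.parity i
  obtain ⟨r, -, hr⟩ := h.eval_zero
  have key : ∀ k, c.eval 0 k ≠ 0 → a ⬝ᵥ k = 0 := fun k hk => by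
    rw [hr] at hk
    rw [← ha, (ite_ne_right_iff.1 hk).1]
    rfl
  refine ⟨Finset.univ.filter fun o => a o = 1, 0, fun k hk => ?_, fun k hk => ?_⟩
  · rw [sum_filter_eq_dotProduct, key k hk]
  · obtain ⟨b, hb⟩ := h.push F hF k
    have h₁ := key (k + t F) fun h₀ => hk (by rw [hb, h₀, Matrix.mul_zero, smul_zero])
    have h₂ : a ⬝ᵥ t F = 1 := (zmod_two_cases _).resolve_left (by rw [← ha]; exact hi)
    rw [dotProduct_add, h₂] at h₁
    rw [sum_filter_eq_dotProduct, zero_add]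
    generalize a ⬝ᵥ k = x at h₁
    revert x; decide

theorem Extracts.syn_add [Fintype O] {c : Circuit O P R} {E : Matrix (Bits R) (Bits P) ℂ}
    {syn : Bits O → Bits S} {f : Fault c →+ Pauli R} {t : Fault c →+ Bits O}
    (h : c.Extracts E syn f t) (k l : Bits O) : syn (k + l) = syn k + syn l := by
  funext i
  obtain ⟨a, ha⟩ := h.parity i
  rw [Pi.add_apply, ha, ha, ha, dotProduct_add]

/-- Without a syndrome, a fault amounts to an output Pauli. -/
theorem Extracts.eval_eq [Fintype O] {c : Circuit O P R} {E : Matrix (Bits R) (Bits P) ℂ}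
    {syn : Bits O → Bits S} {f : Fault c →+ Pauli R} {t : Fault c →+ Bits O}
    (h : c.Extracts E syn f t) :
    ∃ r : ℝ, 0 < r ∧ ∀ F ∈ c.faultGroup, syn (t F) = 0 → ∀ k, ∃ u : ℂ, ‖u‖ = r ∧
      c.eval F k = if syn k = 0 then u • (pauliOp (f F) * E) else 0 := by
  obtain ⟨r, hr, h0⟩ := h.eval_zero
  refine ⟨r, hr, fun F hF hs k => ?_⟩
  obtain ⟨b, hb⟩ := h.push F hF k
  refine ⟨sgn b * r, by rw [norm_mul, norm_sgn, Complex.norm_real, one_mul, Real.norm_of_nonneg hr.le],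
    ?_⟩
  rw [hb, h0, h.syn_add, hs, add_zero]
  split_ifs
  · rw [Matrix.mul_smul, smul_smul]
  · rw [Matrix.mul_zero, smul_zero]

/-- Two circuits that extract the same syndrome are fault-equivalent, if all outcomes of the first
make up the syndrome. -/
theorem Extracts.faultEquivalent {O' : Type} [Fintype O']
    {c : Circuit S P R} {c' : Circuit O' P R} {E : Matrix (Bits R) (Bits P) ℂ}
    {syn : Bits O' → Bits S} {f : Fault c →+ Pauli R} {t : Fault c →+ Bits S}
    {f' : Fault c' →+ Pauli R} {t' : Fault c' →+ Bits O'}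
    (h : c.Extracts E id f t) (h' : c'.Extracts E syn f' t') :
    FaultEquivalent c c' syn := by
  have syn_zero : syn 0 = 0 := by
    funext i
    obtain ⟨a, ha⟩ := h'.parity i
    exact (ha 0).trans (dotProduct_zero a)
  obtain ⟨r, hr, he⟩ := h.eval_eq
  obtain ⟨r', hr', he'⟩ := h'.eval_eq
  have same : ∀ F ∈ c.faultGroup, ∀ F' ∈ c'.faultGroup, t F = 0 → syn (t' F') = 0 → f F = f' F' →
      SameMaps syn (c.eval F) (c'.eval F') := by
    intro F hF F' hF' hs hs' hff
    -- The normalisations `r` and `r'` belong to the circuits and not to the outcomes, so one ratio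
    -- serves all `k'`. In the first circuit only `k = 0` can occur, and it comes from `k' = 0`.
    refine ⟨⟨r' / r, div_pos hr' hr, fun k' => ?_⟩, fun k hk => ⟨0, ?_⟩⟩
    · obtain ⟨u, hu, e⟩ := he F hF hs (syn k')
      obtain ⟨u', hu', e'⟩ := he' F' hF' hs' k'
      have hu0 : u ≠ 0 := by rw [← norm_ne_zero_iff, hu]; exact hr.ne'
      refine ⟨u' / u, by rw [norm_div, hu, hu'], ?_⟩
      rw [e, e', hff]
      by_cases hk : syn k' = 0
      · rw [if_pos hk, if_pos (show id (syn k') = 0 from hk), smul_smul, div_mul_cancel₀ _ hu0]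
      · rw [if_neg hk, if_neg (show ¬ id (syn k') = 0 from hk), smul_zero]
    · obtain ⟨u, -, e⟩ := he F hF hs k
      rw [e] at hk
      rw [syn_zero]
      exact (ite_ne_right_iff.1 hk).1.symm
  refine fun w => ⟨fun F hF _ => ?_, fun F hF _ => ?_⟩
  · by_cases hs : t F = 0
    · have ho := h'.outputFault_mem (f F)
      exact .inr ⟨_, ho.1, ho.2.trans (h.pauliWeight_le hF), same F hF _ ho.1 hs
        (by rw [h'.output_flips, syn_zero]) (h'.output _).symm⟩
    · exact .inl (h.detectable hF hs)
  · by_cases hs : syn (t' F) = 0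
    · have ho := h.outputFault_mem (f' F)
      exact .inr ⟨_, ho.1, ho.2.trans (h'.pauliWeight_le hF), same _ ho.1 F hF
        (h.output_flips _) hs (h.output _)⟩
    · exact .inl (h'.detectable hF hs)

end Circuit

open Circuit

/-! ### Fault-free gates applied to a matrix -/

namespace Circuit

variable {O P Q R α : Type} [Fintype P] [DecidableEq P]

theorem eval_wires_zero_mul (noisy : Set P) (k : Bits O) (M : Matrix (Bits P) α ℂ) :
    (wires P noisy).eval 0 k * M = M := by
  have h : (wires P noisy).eval 0 k = 1 := pauliOp_zero
  rw [h, Matrix.one_mul]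

theorem eval_step_zero_mul [Fintype Q] [DecidableEq Q] (noisy : Set P) (g : Gate O P Q)
    (c : Circuit O Q R) (k : Bits O) (M : Matrix (Bits P) α ℂ) :
    (step noisy g c).eval 0 k * M = c.eval 0 k * (g.op k * M) := by
  have h : (step noisy g c).eval 0 k = c.eval 0 k * (g.op k * pauliOp (Q := P) 0) := rfl
  rw [h, pauliOp_zero, Matrix.mul_one, Matrix.mul_assoc]

end Circuit

section Gates

variable {O α : Type} {n : ℕ}

theorem prepare_mul_apply (ψ : Bits (Fin n) → ℂ) (k : Bits O) (M : Matrix (Bits (Fin n)) α ℂ)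
    (a : Bits (Fin n ⊕ Fin n)) (l : α) :
    ((prepare ψ).op k * M) a l = ψ (fun j => a (.inr j)) * M (fun j => a (.inl j)) l := by
  rw [Matrix.mul_apply]
  simp [prepare]

/-- The CNOT is an involutive permutation of the basis, so it permutes the rows of `M` by the same
formula. -/
theorem cnotToData_mul_apply (k : Bits O) (M : Matrix (Bits (Fin n ⊕ Fin n)) α ℂ)
    (a : Bits (Fin n ⊕ Fin n)) (l : α) :
    ((cnotToData (n := n)).op k * M) a l =
      M (Sum.elim (fun j => a (.inl j) + a (.inr j)) fun j => a (.inr j)) l := by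
  rw [Matrix.mul_apply, Finset.sum_eq_single
    (Sum.elim (fun j => a (.inl j) + a (.inr j)) fun j => a (.inr j))]
  · simp only [cnotToData, Sum.elim_inl, Sum.elim_inr, add_assoc, CharTwo.add_self_eq_zero,
      add_zero, ite_mul, one_mul, zero_mul]
    exact if_pos (by funext q; rcases q with q | q <;> rfl)
  · intro b _ hb
    simp only [cnotToData, ite_mul, one_mul, zero_mul]
    refine if_neg fun h => hb ?_
    subst h
    funext q
    rcases q with q | q <;> simp [add_assoc, CharTwo.add_self_eq_zero]
  · exact fun h => (h (Finset.mem_univ _)).elim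

theorem cnotToAncilla_mul_apply (k : Bits O) (M : Matrix (Bits (Fin n ⊕ Fin n)) α ℂ)
    (a : Bits (Fin n ⊕ Fin n)) (l : α) :
    ((cnotToAncilla (n := n)).op k * M) a l =
      M (Sum.elim (fun j => a (.inl j)) fun j => a (.inr j) + a (.inl j)) l := by
  rw [Matrix.mul_apply, Finset.sum_eq_single
    (Sum.elim (fun j => a (.inl j)) fun j => a (.inr j) + a (.inl j))]
  · simp only [cnotToAncilla, Sum.elim_inl, Sum.elim_inr, add_assoc, CharTwo.add_self_eq_zero,
      add_zero, ite_mul, one_mul, zero_mul]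
    exact if_pos (by funext q; rcases q with q | q <;> rfl)
  · intro b _ hb
    simp only [cnotToAncilla, ite_mul, one_mul, zero_mul]
    refine if_neg fun h => hb ?_
    subst h
    funext q
    rcases q with q | q <;> simp [add_assoc, CharTwo.add_self_eq_zero]
  · exact fun h => (h (Finset.mem_univ _)).elim

theorem measureAncilla_mul_apply (t : Kind) (o : Fin n → O) (k : Bits O)
    (M : Matrix (Bits (Fin n ⊕ Fin n)) α ℂ) (a : Bits (Fin n)) (l : α) :
    ((measureAncilla t o).op k * M) a l =
      ∑ v : Bits (Fin n), (∏ j, t.amplitude (k (o j)) (v j)) * M (Sum.elim a v) l := by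
  rw [Matrix.mul_apply, ← (Equiv.sumArrowEquivProdArrow (Fin n) (Fin n) (ZMod 2)).symm.sum_comp,
    Fintype.sum_prod_type, Finset.sum_eq_single a]
  · refine Finset.sum_congr rfl fun v _ => congrArg (· * _) (if_pos rfl)
  · intro b _ hb
    refine Finset.sum_eq_zero fun v _ => ?_
    exact (congrArg (· * _) (if_neg hb)).trans (zero_mul _)
  · exact fun h => (h (Finset.mem_univ _)).elim

end Gates

open Classical in
/-- The sum of a character of `W`. -/
theorem sum_sgn_dotProduct {n : ℕ} (W : Submodule (ZMod 2) (Bits (Fin n))) (k : Bits (Fin n)) :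
    (∑ v : Bits (Fin n), if v ∈ W then sgn (k ⬝ᵥ v) else 0) =
      if ∀ v ∈ W, k ⬝ᵥ v = 0 then (Nat.card W : ℂ) else 0 := by
  split_ifs with h
  · rw [← Finset.sum_filter, Finset.sum_congr rfl fun v hv => by
      rw [h v (Finset.mem_filter.1 hv).2, sgn_zero]]
    rw [Finset.sum_const, nsmul_one, Nat.card_eq_fintype_card, Fintype.card_subtype]
  · push Not at h
    obtain ⟨w, hw, hkw⟩ := h
    -- Translation by `w` permutes `W` and negates each term, so the sum equals its own negative.
    have h₁ := Equiv.sum_comp (Equiv.addRight w) fun v : Bits (Fin n) =>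
      if v ∈ W then sgn (k ⬝ᵥ v) else 0
    have h₂ : ∀ v : Bits (Fin n), (if v + w ∈ W then sgn (k ⬝ᵥ (v + w)) else 0) =
        -(if v ∈ W then sgn (k ⬝ᵥ v) else 0) := fun v => by
      rw [if_congr (W.add_mem_iff_left hw) rfl rfl, dotProduct_add, sgn_add,
        (zmod_two_cases _).resolve_left hkw]
      split_ifs <;> simp [sgn]
    exact self_eq_neg.1 ((h₁.symm.trans (Finset.sum_congr rfl fun v _ => h₂ v)).trans
      (Finset.sum_neg_distrib _))

/-! ### Fault-free extraction -/

namespace CSSCode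

variable {n m κ : ℕ} (C : CSSCode n m) {E : Matrix (Bits (Fin n)) (Bits (Fin κ)) ℂ}

theorem pauliOp_stab_mul {C : CSSCode n m} (hE : C.IsEncoder E) (i : Fin m) :
    pauliOp (C.stab i) * E = E := by
  ext a b
  have h : E *ᵥ Pi.single b 1 ∈ C.codeSpace := hE.2 ▸ Set.mem_range_self _
  have h' := congrFun (h i) a
  rw [Matrix.mulVec_mulVec, Matrix.mulVec_single_one, Matrix.mulVec_single_one] at h'
  exact h'

/-- Stabilisers act trivially on `E`, so each projector reduces to the scalar `(1 + (-1) ^ k i) /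
2`, which is `1` or `0`. -/
theorem eval_measureList_mul {C : CSSCode n m} (hE : C.IsEncoder E) (l : List (Fin m))
    (noisy : Set (Fin n)) (k : Bits (Fin m)) :
    (C.measureList noisy l).eval 0 k * E = if ∀ i ∈ l, k i = 0 then E else 0 := by
  induction l generalizing noisy with
  | nil =>
    rw [measureList, eval_wires_zero_mul]
    simp
  | cons i l ih =>
    rw [measureList, eval_step_zero_mul]
    simp only [measurePauli, Matrix.smul_mul, Matrix.add_mul, Matrix.one_mul,
      pauliOp_stab_mul hE, Matrix.mul_smul, Matrix.mul_add, ih, List.mem_cons, forall_eq_or_imp]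
    rcases zmod_two_cases (k i) with hk | hk
    · rw [hk, sgn_zero, one_smul, ← two_smul ℂ, smul_smul]
      simp
    · split_ifs <;> simp_all [sgn]

/-- Measurements let Paulis pass unchanged; `Nodup` makes the outcome labels disjoint. -/
theorem measureList_propagates (l : List (Fin m)) (hl : l.Nodup) (noisy : Set (Fin n)) :
    (C.measureList noisy l).PropagatesBy {i | i ∈ l} id := by
  induction l generalizing noisy with
  | nil =>
    have e : {j | j ∈ ([] : List (Fin m))} = ∅ := by ext j; simp
    rw [e]
    exact .wires
  | cons i l ih =>
    have h := (ih (List.nodup_cons.1 hl).2 ∅).step (noisy := noisy)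
      (measurePauli_propagates (C.stab i) i)
      (Set.disjoint_singleton_left.2 (List.nodup_cons.1 hl).1)
      (fun q _ p => pauliWeight_single_le q p) (fun _ h => h.elim)
    have e : {j | j ∈ i :: l} = {i} ∪ {j | j ∈ l} := by ext j; simp
    rw [e]
    exact h

theorem idealExtraction_extracts {C : CSSCode n m} (hE : C.IsEncoder E) :
    ∃ f t, (C.idealExtraction E).Extracts E id f t := by
  refine Extracts.of_propagates (C.measureList_propagates _ (List.nodup_finRange m) _) rfl
    ⟨1, one_pos, fun k => ?_⟩ (fun _ _ => rfl) fun i => ⟨Pi.single i 1, fun k => by simp⟩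
  refine (eval_measureList_mul hE _ _ k).trans (if_congr ?_ (by simp) rfl)
  simp [funext_iff]

/-- Transversality: a fault on data qubit `j`, ancilla qubit `j` or both can spread only within the
`j`-th pair, so it reaches at most data qubit `j`. The circuit is built from its end, since the
weight checks for a gate need the propagation through all later ones. -/
theorem steane_propagates :
    ∃ D ι, PropagatesBy (.step Set.univ (prepare C.logicalZero) <|
      .step Set.univ cnotToData <|
      .step Set.univ (measureAncilla .X Sum.inl) <|
      .step Set.univ (prepare C.logicalPlus) <|
      .step Set.univ cnotToAncilla <|
      .step Set.univ (measureAncilla .Z Sum.inr) <|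
      .wires (Fin n) Set.univ : Circuit (Fin n ⊕ Fin n) (Fin n) (Fin n)) D ι := by
  have wt : ∀ {p : Pauli (Fin n)} (j : Fin n), (∀ i ≠ j, p i = 0) → pauliWeight p ≤ 1 := by
    intro p j h
    have e : p = Pi.single j (p j) := by
      funext i
      by_cases hi : i = j
      · subst hi; rw [Pi.single_eq_same]
      · rw [Pi.single_eq_of_ne hi, h i hi]
    rw [e]; exact pauliWeight_single_le _ _
  have hZ := (PropagatesBy.wires (O := Fin n ⊕ Fin n) (R := Fin n)).step (noisy := Set.univ)
    (measureAncilla_propagates .Z Sum.inr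
      (AddMonoidHom.mk' (fun p => Sum.elim 0 fun j => (p (.inr j)).1) fun p r => by
        funext q; rcases q with q | q <;> simp) (fun _ _ => rfl)
      (by rintro p (i | i) hi; exacts [rfl, (hi ⟨i, rfl⟩).elim])) (by simp)
    (by rintro (j | j) - p <;> refine wt j fun i hi => ?_ <;> simp [dataHom, hi])
    (by rintro _ ⟨j, p, -, rfl⟩; refine wt j fun i hi => ?_; simp [dataHom])
  have hcZ := hZ.step (noisy := Set.univ) cnotToAncilla_propagates (by simp)
    (by rintro (j | j) - p <;> refine wt j fun i hi => ?_ <;> simp [dataHom, cnotToAncillaHom, hi])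
    (by rintro _ ⟨j, p, r, -, rfl⟩; refine wt j fun i hi => ?_; simp [dataHom, hi])
  have hpZ := hcZ.step (noisy := Set.univ) (prepare_propagates C.logicalPlus) (by simp)
    (by intro j _ p; refine wt j fun i hi => ?_; simp [dataHom, cnotToAncillaHom, prepareHom, hi])
    (fun _ h => h.elim)
  have hX := hpZ.step (noisy := Set.univ) (measureAncilla_propagates .X Sum.inl
      (AddMonoidHom.mk' (fun p => Sum.elim (fun j => (p (.inr j)).2) 0) fun p r => by
        funext q; rcases q with q | q <;> simp) (fun _ _ => rfl)
      (by rintro p (i | i) hi; exacts [(hi ⟨i, rfl⟩).elim, rfl]))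
    (by
      rw [Set.disjoint_left]
      rintro _ ⟨i, rfl⟩
      simp)
    (by
      rintro (j | j) - p <;> refine wt j fun i hi => ?_ <;>
        simp [dataHom, cnotToAncillaHom, prepareHom, hi])
    (by
      rintro _ ⟨j, p, -, rfl⟩
      refine wt j fun i hi => ?_
      simp [dataHom, cnotToAncillaHom, prepareHom])
  have hcX := hX.step (noisy := Set.univ) cnotToData_propagates (by simp)
    (by
      rintro (j | j) - p <;> refine wt j fun i hi => ?_ <;>
        simp [dataHom, cnotToAncillaHom, cnotToDataHom, prepareHom, hi])
    (by
      rintro _ ⟨j, p, r, -, rfl⟩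
      refine wt j fun i hi => ?_
      simp [dataHom, cnotToAncillaHom, prepareHom, hi])
  exact ⟨_, _, hcX.step (noisy := Set.univ) (prepare_propagates C.logicalZero) (by simp)
    (by
      intro j _ p
      refine wt j fun i hi => ?_
      simp [dataHom, cnotToAncillaHom, cnotToDataHom, prepareHom, hi])
    (fun _ h => h.elim)⟩

/-- An `X`-stabiliser translates the basis by its support and fixes the columns of `E`; the
invariance extends from the generators to their span. -/
theorem encoder_apply_add {C : CSSCode n m} (hE : C.IsEncoder E) {v : Bits (Fin n)}
    (hv : v ∈ C.xSpan) (a : Bits (Fin n)) (l : Bits (Fin κ)) : E (a + v) l = E a l := by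
  induction hv using Submodule.span_induction generalizing a with
  | mem v hv =>
    obtain ⟨i, hi, rfl⟩ := hv
    have h := congrFun₂ (pauliOp_stab_mul hE i) a l
    have hx : xPart (C.stab i) = C.supp i := by unfold stab; rw [hi]; rfl
    have hz : zPart (C.stab i) = 0 := by unfold stab; rw [hi]; rfl
    rwa [pauliOp_mul_apply, hx, hz, zero_dotProduct, sgn_zero, one_mul] at h
  | zero => rw [add_zero]
  | add v w _ _ hv hw => rw [← add_assoc, hw, hv]
  | smul c v _ hv =>
    rcases zmod_two_cases c with rfl | rfl
    · rw [zero_smul, add_zero]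
    · rw [one_smul, hv]

/-- If `a` violates a `Z`-stabiliser, that stabiliser negates row `a` of `E`, yet fixes `E`; so the
row vanishes. -/
theorem mem_zKer_of_encoder_apply_ne_zero {C : CSSCode n m} (hE : C.IsEncoder E)
    {a : Bits (Fin n)} {l : Bits (Fin κ)} (h : E a l ≠ 0) : a ∈ C.zKer := by
  intro i hi
  have h' := congrFun₂ (pauliOp_stab_mul hE i) a l
  have hx : xPart (C.stab i) = 0 := by unfold stab; rw [hi]; rfl
  have hz : zPart (C.stab i) = C.supp i := by unfold stab; rw [hi]; rfl
  rw [pauliOp_mul_apply, hx, hz, add_zero] at h'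
  refine (zmod_two_cases _).resolve_right fun h₁ => h ?_
  rw [h₁] at h'
  simpa [sgn, neg_eq_self] using h'

theorem forall_mem_xSpan_iff (k : Bits (Fin n)) : (∀ v ∈ C.xSpan, k ⬝ᵥ v = 0) ↔
    ∀ i, C.kind i = .X → C.supp i ⬝ᵥ k = 0 := by
  refine ⟨fun h i hi => ?_, fun h v hv => ?_⟩
  · rw [dotProduct_comm]
    exact h _ (Submodule.subset_span ⟨i, hi, rfl⟩)
  · induction hv using Submodule.span_induction with
    | mem v hv =>
      obtain ⟨i, hi, rfl⟩ := hv
      rw [dotProduct_comm]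
      exact h i hi
    | zero => exact dotProduct_zero k
    | add v w _ _ hv hw => rw [dotProduct_add, hv, hw, add_zero]
    | smul c v _ hv => rw [dotProduct_smul, hv, smul_zero]

open Classical in
-- The CNOTs translate the data by elements of `xSpan`, which `E` does not notice, so the ancilla
-- decouples. Its amplitude is a character sum over `xSpan`: either `0` or the cardinality, which
-- combines with the normalisation of `logicalZero` to the square root.
theorem measureX_mul {C : CSSCode n m} (hE : C.IsEncoder E) (k : Bits (Fin n ⊕ Fin n)) :
    (measureAncilla .X Sum.inl).op k * ((cnotToData (n := n)).op k *
      ((prepare C.logicalZero).op k * E)) =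
      if ∀ i, C.kind i = .X → C.supp i ⬝ᵥ (fun j => k (.inl j)) = 0 then
        ((√(Nat.card C.xSpan) * (1 / √2) ^ n : ℝ) : ℂ) • E else 0 := by
  ext a l
  have hp : ∀ v : Bits (Fin n), ∏ j, Kind.X.amplitude (k (.inl j)) (v j) =
      ((1 / √2 : ℝ) : ℂ) ^ n * sgn ((fun j => k (.inl j)) ⬝ᵥ v) := fun v => by
    simp only [Kind.amplitude, Finset.prod_mul_distrib, Finset.prod_const, Finset.card_univ,
      Fintype.card_fin, dotProduct, sgn_sum]
  have hv : ∀ v : Bits (Fin n), (∏ j, Kind.X.amplitude (k (.inl j)) (v j)) *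
      (C.logicalZero v * E (fun j => a j + v j) l) =
      ((1 / √2 : ℝ) : ℂ) ^ n * ((1 / √(Nat.card C.xSpan : ℝ) : ℝ) : ℂ) * E a l *
        (if v ∈ C.xSpan then sgn ((fun j => k (.inl j)) ⬝ᵥ v) else 0) := fun v => by
    rw [hp, logicalZero]
    split_ifs with h
    · have := encoder_apply_add hE h a l
      rw [show (fun j => a j + v j) = a + v from rfl, this]
      ring
    · ring
  rw [measureAncilla_mul_apply]
  simp only [cnotToData_mul_apply, prepare_mul_apply, Sum.elim_inl, Sum.elim_inr, hv]
  rw [← Finset.mul_sum, sum_sgn_dotProduct, if_congr (C.forall_mem_xSpan_iff _) rfl rfl]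
  split_ifs
  · have hs : ((√(Nat.card C.xSpan : ℝ) : ℝ) : ℂ) * ((√(Nat.card C.xSpan : ℝ) : ℝ) : ℂ) =
        (Nat.card C.xSpan : ℂ) := by
      rw [← Complex.ofReal_mul, Real.mul_self_sqrt (Nat.cast_nonneg _), Complex.ofReal_natCast]
    have h0 : ((√(Nat.card C.xSpan : ℝ) : ℝ) : ℂ) ≠ 0 := by
      rw [Complex.ofReal_ne_zero, Real.sqrt_ne_zero', Nat.cast_pos]
      exact Nat.card_pos
    rw [Matrix.smul_apply, smul_eq_mul, ← hs]
    push_cast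
    field_simp
  · simp

open Classical in
-- The outcome `k` selects the amplitude of `logicalPlus` at `k + a`. Where `E` is non-zero, `a`
-- lies in `zKer`, so the condition on `k + a` is one on `k` alone and nothing about the data is
-- revealed beyond the syndrome.
theorem measureZ_mul {C : CSSCode n m} (hE : C.IsEncoder E) (k : Bits (Fin n ⊕ Fin n)) :
    (measureAncilla .Z Sum.inr).op k * ((cnotToAncilla (n := n)).op k *
      ((prepare C.logicalPlus).op k * E)) =
      if ∀ i, C.kind i = .Z → C.supp i ⬝ᵥ (fun j => k (.inr j)) = 0 then
        ((1 / √(Nat.card C.zKer) : ℝ) : ℂ) • E else 0 := by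
  ext a l
  rw [measureAncilla_mul_apply, Finset.sum_eq_single fun j => k (.inr j)]
  · simp only [cnotToAncilla_mul_apply, prepare_mul_apply, Sum.elim_inl, Sum.elim_inr,
      Kind.amplitude, if_true, Finset.prod_const_one, one_mul]
    by_cases h : E a l = 0
    · split_ifs <;> simp [h]
    · have ha := mem_zKer_of_encoder_apply_ne_zero hE h
      have hk : (fun j => k (.inr j) + a j) ∈ C.zKer ↔
          ∀ i, C.kind i = .Z → C.supp i ⬝ᵥ (fun j => k (.inr j)) = 0 := by
        refine forall₂_congr fun i hi => ?_
        rw [show (fun j => k (.inr j) + a j) = (fun j => k (.inr j)) + a from rfl,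
          dotProduct_add, ha i hi, add_zero]
      rw [logicalPlus, if_congr hk rfl rfl]
      split_ifs <;> simp
  · intro v _ hv
    obtain ⟨j, hj⟩ := Function.ne_iff.1 hv
    rw [Finset.prod_eq_zero (Finset.mem_univ j) (if_neg hj.symm), zero_mul]
  · exact fun h => (h (Finset.mem_univ _)).elim

/-! ### The two halves of Steane extraction combined -/

theorem parities_eq_zero_iff (k : Bits (Fin n ⊕ Fin n)) : C.parities k = 0 ↔
    (∀ i, C.kind i = .X → C.supp i ⬝ᵥ (fun j => k (.inl j)) = 0) ∧
    ∀ i, C.kind i = .Z → C.supp i ⬝ᵥ (fun j => k (.inr j)) = 0 := by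
  rw [funext_iff, ← forall_and]
  refine forall_congr' fun i => ?_
  cases h : C.kind i <;> simp [parities, h, dotProduct]

theorem exists_parities_eq (i : Fin m) :
    ∃ a : Bits (Fin n ⊕ Fin n), ∀ k, C.parities k i = a ⬝ᵥ k := by
  cases h : C.kind i with
  | X => exact ⟨Sum.elim (C.supp i) 0, fun k => by simp [parities, h, dotProduct]⟩
  | Z => exact ⟨Sum.elim 0 (C.supp i), fun k => by simp [parities, h, dotProduct]⟩

theorem steaneExtraction_extracts {C : CSSCode n m} (hE : C.IsEncoder E) :
    ∃ f t, (C.steaneExtraction E).Extracts E C.parities f t := by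
  classical
  obtain ⟨D, ι, hD⟩ := C.steane_propagates
  refine Extracts.of_propagates hD rfl
    ⟨(√(Nat.card C.xSpan) * (1 / √2) ^ n) * (1 / √(Nat.card C.zKer)), ?_, fun k => ?_⟩
    (fun _ _ => rfl) C.exists_parities_eq
  · have : Nonempty C.zKer := ⟨⟨0, fun _ _ => dotProduct_zero _⟩⟩
    have h₁ : 0 < Nat.card C.zKer := Nat.card_pos
    have h₂ : 0 < Nat.card C.xSpan := Nat.card_pos
    positivity
  · have he : (encode E : Gate (Fin n ⊕ Fin n) _ _).op k = E := rfl
    simp only [eval_step_zero_mul, eval_wires_zero_mul]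
    rw [he, measureX_mul hE]
    by_cases hX : ∀ i, C.kind i = .X → C.supp i ⬝ᵥ (fun j => k (.inl j)) = 0
    · rw [if_pos hX, Matrix.mul_smul, Matrix.mul_smul, Matrix.mul_smul, measureZ_mul hE]
      refine (smul_ite _ _ _ _).trans ?_
      rw [smul_zero, smul_smul, ← Complex.ofReal_mul]
      exact if_congr (by rw [parities_eq_zero_iff, and_iff_right hX]) rfl rfl
    · rw [if_neg hX, if_neg (mt (C.parities_eq_zero_iff k).1 fun h => hX h.1)]
      simp only [Matrix.mul_zero]

end CSSCode

end FaultEq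

end

theorem mainTheorem9 {n m κ : ℕ} (C : FaultEq.CSSCode n m) (d : ℕ∞) (hd : C.distance = d)
    (E : Matrix (FaultEq.Bits (Fin n)) (FaultEq.Bits (Fin κ)) ℂ) (hE : C.IsEncoder E) :
    FaultEq.FaultEquivalent (C.idealExtraction E) (C.steaneExtraction E) C.parities := by
  obtain ⟨f, t, h⟩ := FaultEq.CSSCode.idealExtraction_extracts hE
  obtain ⟨f', t', h'⟩ := FaultEq.CSSCode.steaneExtraction_extracts hE
  exact h.faultEquivalent h'
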